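/- All graphs are finite and simple, not necessarily connected. For a graph $G$ let $d=d_G\colon V(G)\times V(G)\to[0,+\infty]$ be the graph distance (with $d(x,y)=+\infty$ if $x,y$ lie in different connected components). For $w,x,y,z\in V(G)$ let $h(w,x,y,z)$ be the difference between the largest and the second largest of the three sums $d(w,x)+d(y,z)$, $d(w,y)+d(x,z)$, $d(w,z)+d(x,y)$, with the convention $\infty-\infty=0$, and let the (Gromov) hyperbolicity of $G$ be $\delta(G)=\frac12\max_{w,x,y,z\in V(G)}h(w,x,y,z)$ (which is $0$ for the empty graph). The graph $G$ is called $0$-hyperbolic if $\delta(G)=0$. A graph $H$ is quantum isomorphic to $G$ if there are a nonzero unital $C^*$-algebra $X$ and a matrix $U=(u_{ax})_{a\in V(H),\,x\in V(G)}$ with coefficients in $X$ that is a magic unitary (every entry satisfies $u_{ax}^2=u_{ax}=u_{ax}^*$, distinct entries in the same row or in the same column have product $0$, and the entries of each row and of each column sum to $1$) and satisfies $U\,\mathrm{Adj}(G)=\mathrm{Adj}(H)\,U$, where $\mathrm{Adj}$ denotes the adjacency matrix. **Theorem.** Let $G$ be a $0$-hyperbolic graph, and let $H$ be a graph quantum isomorphic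 to $G$. Then $H$ is isomorphic to $G$; in particular, $H$ is also $0$-hyperbolic. -/

import Mathlib

open scoped ENNReal

universe u v w

namespace SimpleGraph

/-- The difference between the largest and the second largest of three extended natural numbers,
with the convention `⊤ - ⊤ = 0`. -/
noncomputable def topGap (a b c : ℕ∞) : ℕ∞ :=
  max (max a b) c - max (max (min a b) (min a c)) (min b c)

/-- `topGap` is the difference of the first two terms after arranging in decreasing order. -/
theorem topGap_eq_of_sorted (d : Fin 3 → ℕ∞) (π : Equiv.Perm (Fin 3))
    (h₁ : d (π 1) ≤ d (π 0)) (h₂ : d (π 2) ≤ d (π 1)) :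
    topGap (d 0) (d 1) (d 2) = d (π 0) - d (π 1) := by
  have h01 : π 0 ≠ π 1 := by simp
  have h02 : π 0 ≠ π 2 := by simp
  have h12 : π 1 ≠ π 2 := by simp
  generalize π 0 = i at *
  generalize π 1 = j at *
  generalize π 2 = k at *
  have h₃ := h₂.trans h₁
  unfold topGap
  fin_cases i <;> fin_cases j <;> fin_cases k <;> simp_all

/-- The number `h(w,x,y,z)`: the difference of the two largest of the three sums
`d(w,x) + d(y,z)`, `d(w,y) + d(x,z)`, `d(w,z) + d(x,y)` of extended graph distances. -/
noncomputable def fourPointGap {V : Type*} (G : SimpleGraph V) (w x y z : V) : ℕ∞ :=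
  topGap (G.edist w x + G.edist y z) (G.edist w y + G.edist x z) (G.edist w z + G.edist x y)

/-- Gromov's hyperbolicity constant `δ(G)` of a graph (four-point form), that is, half the
maximum of `h(w,x,y,z)` over all quadruples of vertices. -/
noncomputable def hyperbolicity {V : Type*} (G : SimpleGraph V) : ℝ≥0∞ :=
  (1 / 2) * ⨆ (w : V) (x : V) (y : V) (z : V), (G.fourPointGap w x y z : ℝ≥0∞)

end SimpleGraph

/-- A magic unitary: a matrix of self-adjoint projections in a unital `*`-algebra, pairwise
orthogonal along every row and every column, with all rows and columns summing to `1`. -/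
structure IsMagicUnitary {I J A : Type*} [Fintype I] [Fintype J] [Ring A] [StarRing A]
    (U : Matrix I J A) : Prop where
  isStarProjection : ∀ i j, IsStarProjection (U i j)
  row_orthogonal : ∀ i j k, k ≠ j → U i j * U i k = 0
  col_orthogonal : ∀ i j k, k ≠ i → U i j * U k j = 0
  col_sum : ∀ j, ∑ k, U k j = 1
  row_sum : ∀ i, ∑ k, U i k = 1

namespace SimpleGraph

/-- `U` is a quantum isomorphism from `G` to `H`: a magic unitary indexed by `V(H) × V(G)`, with
coefficients in a unital C⋆-algebra, that intertwines the two adjacency matrices. -/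
structure IsQuantumIsomorphism {V W A : Type*} [Fintype V] [Fintype W] [CStarAlgebra A]
    (G : SimpleGraph V) (H : SimpleGraph W) [DecidableRel G.Adj] [DecidableRel H.Adj]
    (U : Matrix W V A) : Prop where
  isMagicUnitary : IsMagicUnitary U
  intertwines : U * G.adjMatrix A = H.adjMatrix A * U

/-- `H` is quantum isomorphic to `G`: there is a quantum isomorphism from `G` to `H` with
coefficients in some nonzero unital C⋆-algebra. -/
def QuantumIsomorphic {V : Type u} {W : Type v} [Fintype V] [Fintype W]
    (G : SimpleGraph V) (H : SimpleGraph W) [DecidableRel G.Adj] [DecidableRel H.Adj] : Prop :=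
  ∃ (A : Type w) (_ : CStarAlgebra A) (_ : Nontrivial A) (U : Matrix W V A),
    IsQuantumIsomorphism G H U

end SimpleGraph

/-! The matrix `U` acts like an isomorphism that is visible only on pairs. Colorings of the pairs of
`V` and of `W` are intertwined when `U a x * U b y ≠ 0` forces equal colors. Equality and adjacency
are intertwined, and so is the number of `y` for which the colors of `(x, y)` and `(y, z)` satisfy a
given condition, as in two-dimensional Weisfeiler–Leman refinement. Hence distances, and whatever
such counts express, agree on related pairs; the rest is combinatorics.

In a 0-hyperbolic graph the four-point condition gives each vertex a unique parent towards any root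
of its component, and adjacent vertices of one level share their parent. Counts express this, so it
passes to `H`. With one root per component, the children of each vertex fall into cliques, and edges
join only a parent to a child or two siblings in one clique. The color of (root, vertex) determines
how many children there are of each color, and that of (root, child) the colors in the child's
clique. So an isomorphism can be built level by level from matched roots. -/

theorem Set.ncard_setOf {V : Type*} [Fintype V] (p : V → Prop) [DecidablePred p] :
    {x | p x}.ncard = (Finset.univ.filter p).card := by
  rw [← Set.ncard_coe_finset]
  simp

/-! ### Colorings of pairs related by a magic unitary -/

section Coloring

variable {V W A α β : Type*} [CStarAlgebra A] {U : Matrix W V A}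

/-- Two colorings of pairs, on `V` and on `W`, agree wherever the matrix `U` relates the pairs. -/
def Matrix.Intertwines (U : Matrix W V A) (f : V → V → α) (g : W → W → α) : Prop :=
  ∀ a b x y, U a x * U b y ≠ 0 → f x y = g a b

namespace Matrix.Intertwines

theorem prodMk {f : V → V → α} {g : W → W → α} {f' : V → V → β} {g' : W → W → β}
    (h : U.Intertwines f g) (h' : U.Intertwines f' g') :
    U.Intertwines (fun x y => (f x y, f' x y)) (fun a b => (g a b, g' a b)) :=
  fun a b x y hU => Prod.ext (h a b x y hU) (h' a b x y hU)

theorem map {f : V → V → α} {g : W → W → α} (h : U.Intertwines f g) (φ : α → β) :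
    U.Intertwines (fun x y => φ (f x y)) (fun a b => φ (g a b)) :=
  fun a b x y hU => congrArg φ (h a b x y hU)

variable [Fintype V] [Fintype W]

theorem diag (hU : IsMagicUnitary U) {f : V → V → α} {g : W → W → α} (h : U.Intertwines f g) :
    U.Intertwines (fun _ y => f y y) (fun _ b => g b b) := by
  intro a b x y hne
  refine h b b y y fun h0 => hne ?_
  rw [(hU.isStarProjection b y).isIdempotentElem.eq] at h0
  rw [h0, mul_zero]

/-- Sum `U a x * U b y * U c z` over the admissible `y` and all `b`, or over all `y` and the
admissible `b`. A nonzero term makes both adjacent products nonzero, so `y` is admissible iff `b`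
is, and the two sums agree. Since columns and rows sum to `1`, they are the two counts times `U a x
* U c z`. -/
theorem ncard (hU : IsMagicUnitary U) {f : V → V → α} {g : W → W → α}
    {f' : V → V → β} {g' : W → W → β}
    (h : U.Intertwines f g) (h' : U.Intertwines f' g') (P : α → β → Prop) :
    U.Intertwines (fun x z => {y | P (f x y) (f' y z)}.ncard)
      (fun a c => {b | P (g a b) (g' b c)}.ncard) := by
  classical
  intro a c x z hne
  have key : ∀ y b, (if P (f x y) (f' y z) then U a x * U b y * U c z else 0) =
      if P (g a b) (g' b c) then U a x * U b y * U c z else 0 := by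
    intro y b
    by_cases h0 : U a x * U b y * U c z = 0
    · simp [h0]
    · have h1 : U a x * U b y ≠ 0 := fun e => h0 (by rw [e, zero_mul])
      have h2 : U b y * U c z ≠ 0 := fun e => h0 (by rw [mul_assoc, e, mul_zero])
      rw [h _ _ _ _ h1, h' _ _ _ _ h2]
  have e1 : ({y | P (f x y) (f' y z)}.ncard : ℂ) • (U a x * U c z) =
      ∑ y, ∑ b, if P (f x y) (f' y z) then U a x * U b y * U c z else 0 := by
    rw [Set.ncard_setOf, Finset.card_filter, Nat.cast_sum, Finset.sum_smul]
    refine Finset.sum_congr rfl fun y _ => ?_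
    split_ifs
    · rw [← Finset.sum_mul, ← Finset.mul_sum, hU.col_sum]; simp
    · simp
  have e2 : ({b | P (g a b) (g' b c)}.ncard : ℂ) • (U a x * U c z) =
      ∑ b, ∑ y, if P (g a b) (g' b c) then U a x * U b y * U c z else 0 := by
    rw [Set.ncard_setOf, Finset.card_filter, Nat.cast_sum, Finset.sum_smul]
    refine Finset.sum_congr rfl fun b _ => ?_
    split_ifs
    · rw [← Finset.sum_mul, ← Finset.mul_sum, hU.row_sum]; simp
    · simp
  have e3 := e1.trans ((Finset.sum_congr rfl fun y _ => Finset.sum_congr rfl fun b _ =>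
    key y b).trans (Finset.sum_comm.trans e2.symm))
  rw [← sub_eq_zero, ← sub_smul, smul_eq_zero] at e3
  exact_mod_cast sub_eq_zero.1 (e3.resolve_right hne)

/-- The same double counting with the single entries `U b y`, which are idempotent; both counts
appear as multiples of `1 ≠ 0`. -/
theorem ncard_diag [Nontrivial A] (hU : IsMagicUnitary U) {f : V → V → α} {g : W → W → α}
    (h : U.Intertwines f g) (P : α → Prop) :
    {x | P (f x x)}.ncard = {a | P (g a a)}.ncard := by
  classical
  have key : ∀ y b, (if P (f y y) then U b y else 0) = if P (g b b) then U b y else 0 := by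
    intro y b
    by_cases h0 : U b y = 0
    · simp [h0]
    · rw [h b b y y (by rwa [(hU.isStarProjection b y).isIdempotentElem.eq])]
  have e1 : ({x | P (f x x)}.ncard : ℂ) • (1 : A) =
      ∑ y, ∑ b, if P (f y y) then U b y else 0 := by
    rw [Set.ncard_setOf, Finset.card_filter, Nat.cast_sum, Finset.sum_smul]
    refine Finset.sum_congr rfl fun y _ => ?_
    split_ifs
    · rw [hU.col_sum]; simp
    · simp
  have e2 : ({a | P (g a a)}.ncard : ℂ) • (1 : A) =
      ∑ b, ∑ y, if P (g b b) then U b y else 0 := by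
    rw [Set.ncard_setOf, Finset.card_filter, Nat.cast_sum, Finset.sum_smul]
    refine Finset.sum_congr rfl fun b _ => ?_
    split_ifs
    · rw [hU.row_sum]; simp
    · simp
  have e3 := e1.trans ((Finset.sum_congr rfl fun y _ => Finset.sum_congr rfl fun b _ =>
    key y b).trans (Finset.sum_comm.trans e2.symm))
  rw [← sub_eq_zero, ← sub_smul, smul_eq_zero] at e3
  exact_mod_cast sub_eq_zero.1 (e3.resolve_right one_ne_zero)

theorem eq (hU : IsMagicUnitary U) : U.Intertwines (fun x y => x = y) (fun a b => a = b) := by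
  intro a b x y hne
  refine propext ⟨?_, ?_⟩
  · rintro rfl
    by_contra hab
    exact hne (hU.col_orthogonal a x b (Ne.symm hab))
  · rintro rfl
    by_contra hxy
    exact hne (hU.row_orthogonal a x y (Ne.symm hxy))

/-- Multiply the `(a, y)` entry of the intertwining relation by `U a x` on the left and `U b y` on
the right: orthogonality leaves one term on each side. -/
theorem adj {G : SimpleGraph V} {H : SimpleGraph W} [DecidableRel G.Adj] [DecidableRel H.Adj]
    (hU : SimpleGraph.IsQuantumIsomorphism G H U) : U.Intertwines G.Adj H.Adj := by
  intro a b x y hne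
  have h1 := congrFun (congrFun hU.intertwines a) y
  rw [Matrix.mul_apply, Matrix.mul_apply] at h1
  have h2 : U a x * (∑ z, U a z * G.adjMatrix A z y) * U b y =
      if G.Adj x y then U a x * U b y else 0 := by
    rw [Finset.mul_sum, Finset.sum_eq_single x]
    · rw [← mul_assoc, (hU.isMagicUnitary.isStarProjection a x).isIdempotentElem.eq,
        SimpleGraph.adjMatrix_apply]
      split_ifs <;> simp
    · intro z _ hz
      rw [← mul_assoc, hU.isMagicUnitary.row_orthogonal a x z hz, zero_mul]
    · simp
  have h3 : U a x * (∑ c, H.adjMatrix A a c * U c y) * U b y =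
      if H.Adj a b then U a x * U b y else 0 := by
    rw [mul_assoc, Finset.sum_mul, Finset.sum_eq_single b]
    · rw [mul_assoc, (hU.isMagicUnitary.isStarProjection b y).isIdempotentElem.eq,
        SimpleGraph.adjMatrix_apply]
      split_ifs <;> simp
    · intro c _ hc
      rw [mul_assoc, hU.isMagicUnitary.col_orthogonal c y b hc.symm, mul_zero]
    · simp
  rw [h1, h3] at h2
  split_ifs at h2 with hH hG hG
  · simp [hH, hG]
  · exact absurd h2 hne
  · exact absurd h2.symm hne
  · simp [hH, hG]

end Matrix.Intertwines

/-- Otherwise the product of two row sums, which is `1`, would vanish. Every pair in `H` is thus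
related to some pair in `G`, from which properties can be transported. -/
theorem IsMagicUnitary.exists_mul_ne_zero [Fintype V] [Fintype W] [Nontrivial A]
    (hU : IsMagicUnitary U) (a b : W) :
    ∃ x y, U a x * U b y ≠ 0 := by
  by_contra! h
  have h1 : (∑ x, U a x) * ∑ y, U b y = 0 := by
    rw [Finset.sum_mul_sum]
    exact Finset.sum_eq_zero fun x _ => Finset.sum_eq_zero fun y _ => h x y
  rw [hU.row_sum, hU.row_sum, one_mul] at h1
  exact one_ne_zero h1

/-- The colors of the finest pair of colorings intertwined by `U`. -/
def Matrix.Color (U : Matrix W V A) : Type _ :=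
  Quot fun p q : (V × V) ⊕ (W × W) =>
    ∃ a b x y, U a x * U b y ≠ 0 ∧ p = Sum.inl (x, y) ∧ q = Sum.inr (a, b)

/-- The finest coloring of the pairs of columns. -/
def Matrix.colColor (U : Matrix W V A) (x y : V) : U.Color := Quot.mk _ (Sum.inl (x, y))

/-- The finest coloring of the pairs of rows. -/
def Matrix.rowColor (U : Matrix W V A) (a b : W) : U.Color := Quot.mk _ (Sum.inr (a, b))

theorem Matrix.intertwines_color (U : Matrix W V A) : U.Intertwines U.colColor U.rowColor :=
  fun a b x y h => Quot.sound ⟨a, b, x, y, h, rfl, rfl⟩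

/-- Intertwined colorings factor through the quotient. Equal colors only mean a chain of nonzero
products, so this is what makes them usable for pairs not directly related by `U`. -/
theorem Matrix.Intertwines.eq_of_color_eq {f : V → V → α} {g : W → W → α}
    (h : U.Intertwines f g) {x y : V} {a b : W} (hc : U.colColor x y = U.rowColor a b) :
    f x y = g a b := by
  have := congrArg (Quot.lift (Sum.elim (fun p => f p.1 p.2) (fun q => g q.1 q.2)) (by
    rintro _ _ ⟨a, b, x, y, hne, rfl, rfl⟩
    exact h a b x y hne)) hc
  exact this

end Coloring

/-! ### Distances are intertwined -/

theorem SimpleGraph.edist_le_succ_iff {V : Type*} (G : SimpleGraph V) (x z : V) (n : ℕ) :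
    G.edist x z ≤ (n + 1 : ℕ) ↔ ∃ y, G.edist x y ≤ n ∧ (y = z ∨ G.Adj y z) := by
  constructor
  · intro h
    have hr : G.Reachable x z := by
      rw [← G.edist_ne_top_iff_reachable]
      exact ne_top_of_le_ne_top (ENat.natCast_ne_top _) h
    obtain ⟨p, hp⟩ := hr.exists_walk_length_eq_edist
    rw [← hp] at h
    have hlen : p.length ≤ n + 1 := by exact_mod_cast h
    by_cases hn : p.length ≤ n
    · exact ⟨z, (SimpleGraph.edist_le p).trans (by exact_mod_cast hn), Or.inl rfl⟩
    · have hnil : ¬ p.Nil := by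
        rw [← SimpleGraph.Walk.length_eq_zero_iff]; omega
      refine ⟨p.penultimate, (SimpleGraph.edist_le p.dropLast).trans ?_,
        Or.inr (p.adj_penultimate hnil)⟩
      have : p.dropLast.length ≤ n := by
        simp; omega
      exact_mod_cast this
  · rintro ⟨y, hy, rfl | hyz⟩
    · exact hy.trans (by exact_mod_cast Nat.le_succ n)
    · refine (G.edist_triangle (v := y)).trans ?_
      rw [SimpleGraph.edist_eq_one_iff_adj.2 hyz, Nat.cast_add, Nat.cast_one]
      gcongr

/-- Having distance at most `n + 1` means that a count of intermediate vertices is positive, so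
induction on `n` applies; an extended natural is determined by its finite upper bounds. -/
theorem Matrix.Intertwines.edist {V W A : Type*} [Fintype V] [Fintype W] [CStarAlgebra A]
    {U : Matrix W V A} {G : SimpleGraph V} {H : SimpleGraph W} [DecidableRel G.Adj]
    [DecidableRel H.Adj] (hU : SimpleGraph.IsQuantumIsomorphism G H U) :
    U.Intertwines G.edist H.edist := by
  classical
  have hM := hU.isMagicUnitary
  have hle : ∀ n : ℕ, U.Intertwines (fun x y => G.edist x y ≤ n) (fun a b => H.edist a b ≤ n) := by
    intro n
    induction n with
    | zero => simpa using Matrix.Intertwines.eq hM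
    | succ n ih =>
      have h := (Matrix.Intertwines.ncard hM ih
        ((Matrix.Intertwines.eq hM).prodMk (Matrix.Intertwines.adj hU))
        fun p q => p ∧ (q.1 ∨ q.2)).map (fun k => 0 < k)
      intro a b x y hne
      have := h a b x y hne
      simpa only [SimpleGraph.edist_le_succ_iff, Set.ncard_pos (Set.toFinite _),
        Set.Nonempty, Set.mem_ofPred_eq] using this
  intro a b x y hne
  have hiff : ∀ n : ℕ, G.edist x y ≤ n ↔ H.edist a b ≤ n := fun n => iff_of_eq (hle n a b x y hne)
  refine le_antisymm ?_ ?_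
  · generalize H.edist a b = t at hiff ⊢
    cases t with
    | top => exact le_top
    | coe k => exact (hiff k).2 le_rfl
  · generalize G.edist x y = t at hiff ⊢
    cases t with
    | top => exact le_top
    | coe k => exact (hiff k).1 le_rfl

/-! ### From 0-hyperbolicity to unique and common parents -/

namespace SimpleGraph

variable {V W : Type*} {G : SimpleGraph V} {H : SimpleGraph W}

theorem edist_map_le (f : G →g H) (x y : V) : H.edist (f x) (f y) ≤ G.edist x y :=
  le_iInf fun p => (edist_le (p.map f)).trans (by simp)

theorem Iso.edist_eq (e : G ≃g H) (x y : V) : H.edist (e x) (e y) = G.edist x y :=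
  le_antisymm (edist_map_le e.toHom x y) (by simpa using edist_map_le e.symm.toHom (e x) (e y))

theorem hyperbolicity_eq_zero_iff :
    G.hyperbolicity = 0 ↔ ∀ w x y z, G.fourPointGap w x y z = 0 := by
  simp [hyperbolicity]

theorem Iso.hyperbolicity_eq_zero (e : H ≃g G) (hG : G.hyperbolicity = 0) :
    H.hyperbolicity = 0 := by
  rw [hyperbolicity_eq_zero_iff] at hG ⊢
  intro w x y z
  simpa only [fourPointGap, e.edist_eq] using hG (e w) (e x) (e y) (e z)

theorem four_point_of_hyperbolicity_eq_zero (hG : G.hyperbolicity = 0) {w x y z : V}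
    (hx : G.Reachable w x) (hy : G.Reachable w y) (hz : G.Reachable w z) :
    max (max (G.dist w x + G.dist y z) (G.dist w y + G.dist x z)) (G.dist w z + G.dist x y) ≤
      max (max (min (G.dist w x + G.dist y z) (G.dist w y + G.dist x z))
        (min (G.dist w x + G.dist y z) (G.dist w z + G.dist x y)))
        (min (G.dist w y + G.dist x z) (G.dist w z + G.dist x y)) := by
  have h := hyperbolicity_eq_zero_iff.1 hG w x y z
  rw [fourPointGap, topGap, ← hx.coe_dist_eq_edist, ← hy.coe_dist_eq_edist,
    ← hz.coe_dist_eq_edist, ← (hx.symm.trans hy).coe_dist_eq_edist,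
    ← (hx.symm.trans hz).coe_dist_eq_edist, ← (hy.symm.trans hz).coe_dist_eq_edist,
    tsub_eq_zero_iff_le] at h
  have hmono : Monotone ((↑) : ℕ → ℕ∞) := Nat.mono_cast
  simpa only [← Nat.cast_add, ← hmono.map_max, ← hmono.map_min, Nat.cast_le] using h

theorem exists_adj_dist_eq {x y : V} {n : ℕ} (h : G.dist x y = n + 1) :
    ∃ p, G.Adj p y ∧ G.dist x p = n := by
  -- `dist` is `0` between different components, so a positive value implies reachability.
  have hr : G.Reachable x y := Reachable.of_dist_ne_zero (by omega)
  obtain ⟨q, hq⟩ := hr.exists_walk_length_eq_dist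
  have hnil : ¬ q.Nil := by
    rw [← Walk.length_eq_zero_iff]; omega
  refine ⟨q.penultimate, q.adj_penultimate hnil, ?_⟩
  have h1 : G.dist x q.penultimate ≤ n := (dist_le q.dropLast).trans (by simp; omega)
  have h2 := (q.adj_penultimate hnil).diff_dist_adj (u := x)
  omega

/-- Seen from any vertex, every other vertex of its component has exactly one neighbor closer to
that vertex, and adjacent equidistant vertices have the same such neighbor. These are the graphs
all of whose blocks are complete. -/
structure IsBlockForest (G : SimpleGraph V) : Prop where
  parent_unique : ∀ {x y p q : V} {n : ℕ}, G.dist x y = n + 1 → G.Adj p y → G.Adj q y →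
    G.dist x p = n → G.dist x q = n → p = q
  exists_common_parent : ∀ {x y z : V} {n : ℕ}, G.dist x y = n + 1 → G.dist x z = n + 1 →
    G.Adj y z → ∃ p, G.Adj p y ∧ G.Adj p z ∧ G.dist x p = n

theorem isBlockForest_of_hyperbolicity_eq_zero (hG : G.hyperbolicity = 0) : G.IsBlockForest where
  parent_unique {x y p q n} hy hp hq hxp hxq := by
    by_contra hpq
    have hr : G.Reachable x y := Reachable.of_dist_ne_zero (by omega)
    have hpr := hr.trans hp.symm.reachable
    have hqr := hr.trans hq.symm.reachable
    -- Two of the sums equal `n + 1`, while the third is `n + 1 + d(p,q)`.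
    have h := four_point_of_hyperbolicity_eq_zero hG hr hpr hqr
    have h1 : 0 < G.dist p q := (hpr.symm.trans hqr).pos_dist_of_ne hpq
    rw [dist_eq_one_iff_adj.2 hp.symm, dist_eq_one_iff_adj.2 hq.symm] at h
    omega
  exists_common_parent {x y z n} hy hz hyz := by
    obtain ⟨p, hp, hxp⟩ := exists_adj_dist_eq hy
    refine ⟨p, hp, ?_, hxp⟩
    have hr : G.Reachable x y := Reachable.of_dist_ne_zero (by omega)
    have hpr := hr.trans hp.symm.reachable
    have hzr := hr.trans hyz.reachable
    -- The sums are `n + 1`, `n + 2` and `n + 1 + d(p,z)`, which leaves only `d(p,z) = 1`.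
    have h := four_point_of_hyperbolicity_eq_zero hG hpr hr hzr
    have hpz : p ≠ z := by rintro rfl; omega
    have h1 : 0 < G.dist p z := (hpr.symm.trans hzr).pos_dist_of_ne hpz
    rw [dist_eq_one_iff_adj.2 hp, dist_eq_one_iff_adj.2 hyz] at h
    rw [← dist_eq_one_iff_adj]
    omega

theorem dist_eq_succ_of_adj_of_adj {x y z p : V} {n : ℕ}
    (hG : ∀ {q}, G.Adj q y → G.dist x q = n → p = q)
    (hy : G.dist x y = n + 1) (hxp : G.dist x p = n) (hpz : G.Adj p z) (hzy : G.Adj z y) :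
    G.dist x z = n + 1 := by
  have h1 := hpz.diff_dist_adj (u := x)
  have h2 := hzy.diff_dist_adj (u := x)
  have h3 : G.dist x z ≠ n := fun h => hpz.ne (hG hzy h)
  omega

/-- Uniqueness of parents is a count being at most `1`. A common parent involves four vertices, so
it is recast by nested counts: some parent of `y` has as many common neighbors with `y` as `y` has
neighbors on its own level. Unique parents make the former set part of the latter, so equal size
means equality. -/
theorem IsQuantumIsomorphism.isBlockForest {A : Type*} [Fintype V] [Fintype W] [CStarAlgebra A]
    [Nontrivial A] [DecidableRel G.Adj] [DecidableRel H.Adj] {U : Matrix W V A}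
    (hU : IsQuantumIsomorphism G H U) (hG : G.IsBlockForest) : H.IsBlockForest := by
  have hM := hU.isMagicUnitary
  have hadj := Matrix.Intertwines.adj hU
  have hdist : U.Intertwines G.dist H.dist := (Matrix.Intertwines.edist hU).map ENat.toNat
  have huniq : ∀ {x y p q : W} {n : ℕ}, H.dist x y = n + 1 → H.Adj p y → H.Adj q y →
      H.dist x p = n → H.dist x q = n → p = q := by
    intro a b p q n hab hp hq hap haq
    obtain ⟨x, y, hne⟩ := hM.exists_mul_ne_zero a b
    have hxy := hdist a b x y hne
    have hcard := Matrix.Intertwines.ncard hM hdist hadj (fun d e => d = n ∧ e) a b x y hne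
    have hle : {z | G.dist x z = n ∧ G.Adj z y}.ncard ≤ 1 := by
      rw [Set.ncard_le_one (Set.toFinite _)]
      intro r hr s hs
      simp only [Set.mem_ofPred_eq] at hr hs
      exact hG.parent_unique (hxy.trans hab) hr.2 hs.2 hr.1 hs.1
    dsimp only at hcard
    rw [hcard, Set.ncard_le_one (Set.toFinite _)] at hle
    exact hle p (by simp [hp, hap]) q (by simp [hq, haq])
  refine ⟨huniq, ?_⟩
  intro a b c n hab hac hbc
  obtain ⟨x, y, hne⟩ := hM.exists_mul_ne_zero a b
  have hxy := (hdist a b x y hne).trans hab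
  have hcommon := Matrix.Intertwines.ncard hM hadj hadj (fun d e => d ∧ e)
  have hlevel := Matrix.Intertwines.ncard hM hdist hadj (fun d e => d = n + 1 ∧ e) a b x y hne
  -- The cardinality on the right is a fixed number here; `hlevel` identifies it with the
  -- corresponding one in `G`.
  have hcard := Matrix.Intertwines.ncard hM hdist (hadj.prodMk hcommon)
    (fun d e => d = n ∧ e.1 ∧
      e.2 = {z | H.dist a z = n + 1 ∧ H.Adj z b}.ncard) a b x y hne
  dsimp only at hlevel hcard
  obtain ⟨p, hp, hxp⟩ := exists_adj_dist_eq hxy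
  have hpos : 0 < {q | G.dist x q = n ∧ G.Adj q y ∧
      {z | G.Adj q z ∧ G.Adj z y}.ncard =
      {z | H.dist a z = n + 1 ∧ H.Adj z b}.ncard}.ncard := by
    refine (Set.ncard_pos (Set.toFinite _)).2 ⟨p, ?_⟩
    simp only [Set.mem_ofPred_eq]
    refine ⟨hxp, hp, ?_⟩
    rw [← hlevel]
    congr 1
    ext z
    simp only [Set.mem_ofPred_eq]
    constructor
    · rintro ⟨hpz, hzy⟩
      exact ⟨dist_eq_succ_of_adj_of_adj (fun hq hxq => hG.parent_unique hxy hp hq hxp hxq)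
        hxy hxp hpz hzy, hzy⟩
    · rintro ⟨hxz, hzy⟩
      obtain ⟨q, hqz, hqy, hxq⟩ := hG.exists_common_parent hxz hxy hzy
      rw [hG.parent_unique hxy hp hqy hxp hxq]
      exact ⟨hqz, hzy⟩
  rw [hcard] at hpos
  obtain ⟨q, hq⟩ := (Set.ncard_pos (Set.toFinite _)).1 hpos
  simp only [Set.mem_ofPred_eq] at hq
  obtain ⟨haq, hqb, hq⟩ := hq
  have hsub : {z | H.Adj q z ∧ H.Adj z b} ⊆
      {z | H.dist a z = n + 1 ∧ H.Adj z b} := by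
    intro z
    simp only [Set.mem_ofPred_eq]
    rintro ⟨hqz, hzb⟩
    exact ⟨dist_eq_succ_of_adj_of_adj (fun hr har => huniq hab hqb hr haq har)
      hab haq hqz hzb, hzb⟩
  have hmem : c ∈ {z | H.Adj q z ∧ H.Adj z b} := by
    rw [Set.eq_of_subset_of_ncard_le hsub hq.ge (Set.toFinite _)]
    simp [hac, hbc.symm]
  simp only [Set.mem_ofPred_eq] at hmem
  exact ⟨q, hqb, hmem.1, haq⟩

end SimpleGraph

/-! ### Matching colored sets with equivalence classes -/

theorem Set.exists_bijOn_of_ncard_fiber_eq {V W α : Type*} [Finite V] [Finite W] [Nonempty W]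
    (S : Set V) (T : Set W) (f : V → α) (g : W → α)
    (h : ∀ c, {s | s ∈ S ∧ f s = c}.ncard = {t | t ∈ T ∧ g t = c}.ncard) :
    ∃ φ : V → W, Set.BijOn φ S T ∧ ∀ s ∈ S, g (φ s) = f s := by
  classical
  have h1 : ∀ c, ∃ φ : V → W, Set.BijOn φ {s | s ∈ S ∧ f s = c} {t | t ∈ T ∧ g t = c} := by
    intro c
    obtain ⟨e⟩ : Nonempty ({s | s ∈ S ∧ f s = c} ≃ {t | t ∈ T ∧ g t = c}) :=
      Finite.card_eq.1 (h c)
    refine ⟨fun s => if hs : s ∈ S ∧ f s = c then e ⟨s, hs⟩ else Classical.arbitrary W,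
      ?_, ?_, ?_⟩
    · intro s hs
      have hs' : s ∈ S ∧ f s = c := hs
      simp only [hs', and_self, dif_pos]
      exact (e ⟨s, hs'⟩).2
    · intro s hs t ht hst
      have hs' : s ∈ S ∧ f s = c := hs
      have ht' : t ∈ S ∧ f t = c := ht
      simp only [hs', ht', and_self, dif_pos] at hst
      simpa using e.injective (Subtype.ext hst)
    · intro t ht
      have h2 : (e.symm ⟨t, ht⟩ : V) ∈ S ∧ f (e.symm ⟨t, ht⟩) = c := (e.symm ⟨t, ht⟩).2
      refine ⟨e.symm ⟨t, ht⟩, h2, ?_⟩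
      dsimp only
      rw [dif_pos h2]
      exact congrArg Subtype.val (e.apply_symm_apply ⟨t, ht⟩)
  choose φ hφ using h1
  have hmem : ∀ s ∈ S, φ (f s) s ∈ T ∧ g (φ (f s) s) = f s :=
    fun s hs => (hφ (f s)).mapsTo (x := s) ⟨hs, rfl⟩
  refine ⟨fun s => φ (f s) s, ⟨fun s hs => (hmem s hs).1, ?_, ?_⟩, fun s hs => (hmem s hs).2⟩
  · intro s hs t ht hst
    have hst' : φ (f s) s = φ (f t) t := hst
    have hfe : f s = f t := by rw [← (hmem s hs).2, ← (hmem t ht).2, hst']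
    rw [← hfe] at hst'
    exact (hφ (f s)).injOn ⟨hs, rfl⟩ ⟨ht, hfe.symm⟩ hst'
  · intro t ht
    obtain ⟨s, ⟨hs, hfs⟩, hst⟩ := (hφ (g t)).surjOn (a := t) ⟨ht, rfl⟩
    exact ⟨s, hs, by simp only [hfs, hst]⟩

theorem Set.ncard_and_add_ncard_not_and {V : Type*} [Finite V] (p q : V → Prop) :
    {x | p x ∧ q x}.ncard + {x | ¬ p x ∧ q x}.ncard = {x | q x}.ncard := by
  rw [← Set.ncard_inter_add_ncard_sdiff_eq_ncard {x | q x} {x | p x} (Set.toFinite _)]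
  congr 2 <;> (ext x; simp [and_comm])

/-- Two colored finite sets with equivalence relations are matched by a bijection preserving colors
and relations if every color occurs equally often, and the colors occurring in a class are
determined, with multiplicity, by the color of any of its elements. -/
theorem Set.exists_bijOn_of_ncard_class_eq {V W α : Type*} [Finite V] [Finite W] [Nonempty W]
    (f : V → α) (g : W → α) (r : V → V → Prop) (r' : W → W → Prop)
    (hrefl : ∀ s, r s s)
    (hsymm : ∀ s t, r s t → r t s) (hsymm' : ∀ s t, r' s t → r' t s)
    (S : Set V) (T : Set W)
    (htrans : ∀ s ∈ S, ∀ t ∈ S, ∀ u ∈ S, r s t → r t u → r s u)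
    (htrans' : ∀ s ∈ T, ∀ t ∈ T, ∀ u ∈ T, r' s t → r' t u → r' s u)
    (htot : ∀ c, {s | s ∈ S ∧ f s = c}.ncard = {t | t ∈ T ∧ g t = c}.ncard)
    (hcls : ∀ s ∈ S, ∀ t ∈ T, f s = g t → ∀ c,
      {u | u ∈ S ∧ r s u ∧ f u = c}.ncard = {u | u ∈ T ∧ r' t u ∧ g u = c}.ncard) :
    ∃ φ : V → W, Set.BijOn φ S T ∧ (∀ s ∈ S, g (φ s) = f s) ∧
      ∀ s ∈ S, ∀ t ∈ S, (r s t ↔ r' (φ s) (φ t)) := by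
  classical
  induction hn : S.ncard using Nat.strong_induction_on generalizing S T with
  | _ n ih =>
  rcases S.eq_empty_or_nonempty with rfl | ⟨s, hs⟩
  · have hT : T = ∅ := by
      refine Set.eq_empty_of_forall_notMem fun t ht => ?_
      have := htot (g t)
      simp only [Set.mem_empty_iff_false, false_and] at this
      rw [Set.ofPred_false, Set.ncard_empty, eq_comm, Set.ncard_eq_zero (Set.toFinite _)] at this
      exact this.le (show t ∈ {u | u ∈ T ∧ g u = g t} from ⟨ht, rfl⟩)
    subst hT
    exact ⟨fun _ => Classical.arbitrary W, by simp, by simp, by simp⟩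
  obtain ⟨t, ht, hst⟩ : ∃ t ∈ T, g t = f s := by
    have : 0 < {t | t ∈ T ∧ g t = f s}.ncard := by
      rw [← htot]
      exact (Set.ncard_pos (Set.toFinite _)).2 ⟨s, hs, rfl⟩
    exact (Set.ncard_pos (Set.toFinite _)).1 this
  have hc := hcls s hs t ht hst.symm
  -- All elements of a class are related, so any color-preserving bijection between the two classes
  -- will do; both classes are then removed.
  obtain ⟨φ₁, hφ₁, hcol₁⟩ := Set.exists_bijOn_of_ncard_fiber_eq
    {u | u ∈ S ∧ r s u} {u | u ∈ T ∧ r' t u} f g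
    (by simpa only [Set.mem_ofPred_eq, and_assoc] using hc)
  obtain ⟨φ₂, hφ₂, hcol₂, hrel₂⟩ := ih {u | u ∈ S ∧ ¬ r s u}.ncard
    (by
      rw [← hn]
      refine Set.ncard_lt_ncard ⟨fun u hu => hu.1, fun hsub => (hsub hs).2 (hrefl s)⟩
        (Set.toFinite _))
    {u | u ∈ S ∧ ¬ r s u} {u | u ∈ T ∧ ¬ r' t u}
    (fun a ha b hb c hc => htrans a ha.1 b hb.1 c hc.1)
    (fun a ha b hb c hc => htrans' a ha.1 b hb.1 c hc.1)
    (by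
      intro c
      have h1 := Set.ncard_and_add_ncard_not_and (r s) (fun u => u ∈ S ∧ f u = c)
      have h2 := Set.ncard_and_add_ncard_not_and (r' t) (fun u => u ∈ T ∧ g u = c)
      have h3 := hc c
      have h4 := htot c
      simp only [Set.mem_ofPred_eq, and_assoc, and_left_comm (a := _ ∈ S),
        and_left_comm (a := _ ∈ T)] at h1 h2 h3 h4 ⊢
      omega)
    (by
      intro a ha b hb hab c
      have h := hcls a ha.1 b hb.1 hab c
      -- The class of an element outside the class of `s` is disjoint from it, so the removal leaves
      -- it intact.
      have e1 : {u | u ∈ {u | u ∈ S ∧ ¬ r s u} ∧ r a u ∧ f u = c} =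
          {u | u ∈ S ∧ r a u ∧ f u = c} := by
        ext u
        exact ⟨fun hu => ⟨hu.1.1, hu.2⟩, fun hu => ⟨⟨hu.1, fun hsu =>
          ha.2 (htrans s hs u hu.1 a ha.1 hsu (hsymm _ _ hu.2.1))⟩, hu.2⟩⟩
      have e2 : {u | u ∈ {u | u ∈ T ∧ ¬ r' t u} ∧ r' b u ∧ g u = c} =
          {u | u ∈ T ∧ r' b u ∧ g u = c} := by
        ext u
        exact ⟨fun hu => ⟨hu.1.1, hu.2⟩, fun hu => ⟨⟨hu.1, fun hsu =>
          hb.2 (htrans' t ht u hu.1 b hb.1 hsu (hsymm' _ _ hu.2.1))⟩, hu.2⟩⟩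
      rw [e1, e2, h])
    rfl
  have hm₁ : ∀ u ∈ S, r s u → φ₁ u ∈ T ∧ r' t (φ₁ u) := fun u hu hsu => hφ₁.mapsTo ⟨hu, hsu⟩
  have hm₂ : ∀ u ∈ S, ¬ r s u → φ₂ u ∈ T ∧ ¬ r' t (φ₂ u) := fun u hu hsu => hφ₂.mapsTo ⟨hu, hsu⟩
  refine ⟨fun u => if r s u then φ₁ u else φ₂ u, ⟨?_, ?_, ?_⟩, ?_, ?_⟩
  · intro u hu
    dsimp only
    split_ifs with h
    · exact (hm₁ u hu h).1
    · exact (hm₂ u hu h).1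
  · intro u hu v hv huv
    dsimp only at huv
    split_ifs at huv with h h' h'
    · exact hφ₁.injOn ⟨hu, h⟩ ⟨hv, h'⟩ huv
    · exact absurd (huv ▸ (hm₁ u hu h).2) (hm₂ v hv h').2
    · exact absurd (huv ▸ (hm₁ v hv h').2) (hm₂ u hu h).2
    · exact hφ₂.injOn ⟨hu, h⟩ ⟨hv, h'⟩ huv
  · intro b hb
    by_cases h : r' t b
    · obtain ⟨u, hu, rfl⟩ := hφ₁.surjOn (show b ∈ {u | u ∈ T ∧ r' t u} from ⟨hb, h⟩)
      exact ⟨u, hu.1, if_pos hu.2⟩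
    · obtain ⟨u, hu, rfl⟩ := hφ₂.surjOn (show b ∈ {u | u ∈ T ∧ ¬ r' t u} from ⟨hb, h⟩)
      exact ⟨u, hu.1, if_neg hu.2⟩
  · intro u hu
    dsimp only
    split_ifs with h
    · exact hcol₁ u ⟨hu, h⟩
    · exact hcol₂ u ⟨hu, h⟩
  · intro u hu v hv
    dsimp only
    split_ifs with h h' h'
    · exact iff_of_true (htrans u hu s hs v hv (hsymm _ _ h) h')
        (htrans' _ (hm₁ u hu h).1 t ht _ (hm₁ v hv h').1 (hsymm' _ _ (hm₁ u hu h).2)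
          (hm₁ v hv h').2)
    · exact iff_of_false (fun huv => h' (htrans s hs u hu v hv h huv))
        fun huv => (hm₂ v hv h').2 (htrans' t ht _ (hm₁ u hu h).1 _ (hm₂ v hv h').1
          (hm₁ u hu h).2 huv)
    · exact iff_of_false (fun huv => h (htrans s hs v hv u hu h' (hsymm _ _ huv)))
        fun huv => (hm₂ u hu h).2 (htrans' t ht _ (hm₁ v hv h').1 _ (hm₂ u hu h).1
          (hm₁ v hv h').2 (hsymm' _ _ huv))
    · exact hrel₂ u ⟨hu, h⟩ v ⟨hv, h'⟩

/-! ### Children and their cliques -/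

namespace SimpleGraph

section BlockForest

variable {V : Type*} {G : SimpleGraph V}

theorem IsBlockForest.eq_of_dist_eq (hG : G.IsBlockForest) {r x y z : V}
    (hxz : G.Adj x z) (hyz : G.Adj y z) (hx : G.dist r z = G.dist r x + 1)
    (hy : G.dist r y = G.dist r x) : x = y :=
  hG.parent_unique hx hxz hyz rfl hy

theorem IsBlockForest.adj_of_adj (hG : G.IsBlockForest) {r x y z : V} (hxy : G.Adj x y)
    (hyz : G.Adj y z) (hy : G.dist r y = G.dist r x + 1) (hz : G.dist r z = G.dist r x + 1) :
    G.Adj x z := by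
  obtain ⟨p, hpy, hpz, hp⟩ := hG.exists_common_parent hy hz hyz
  rwa [hG.parent_unique hy hxy hpy rfl hp]

/-- Otherwise `w` and `z` are at distance `2`, and seen from `w` the vertex `z` has the two parents
`x` and `y`. -/
theorem IsBlockForest.eq_or_adj_of_adj_of_adj (hG : G.IsBlockForest) {x y w z : V} (hxy : x ≠ y)
    (hxw : G.Adj x w) (hxz : G.Adj x z) (hyw : G.Adj y w) (hyz : G.Adj y z) :
    w = z ∨ G.Adj w z := by
  by_contra! h
  have h1 := dist_eq_one_iff_adj.2 hxw.symm
  have h2 := hxz.diff_dist_adj (u := w)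
  have h3 : G.dist w z ≠ 1 := fun e => h.2 (dist_eq_one_iff_adj.1 e)
  have h4 := (hxw.symm.reachable.trans hxz.reachable).pos_dist_of_ne h.1
  exact hxy (hG.parent_unique (n := 1) (by omega) hxz hyz h1 (dist_eq_one_iff_adj.2 hyw.symm))

/-- The neighbors of `x` that are one step farther from `r` than `x`. -/
def children (G : SimpleGraph V) (r x : V) : Set V :=
  {w | G.Adj x w ∧ G.dist r w = G.dist r x + 1}

theorem IsBlockForest.children_trans (hG : G.IsBlockForest) {r x : V} :
    ∀ s ∈ G.children r x, ∀ t ∈ G.children r x, ∀ u ∈ G.children r x,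
      (s = t ∨ G.Adj s t) → (t = u ∨ G.Adj t u) → (s = u ∨ G.Adj s u) := by
  rintro s ⟨hs, hs'⟩ t ⟨ht, ht'⟩ u ⟨hu, hu'⟩ (rfl | hst) (rfl | htu)
  · exact Or.inl rfl
  · exact Or.inr htu
  · exact Or.inr hst
  · exact hG.eq_or_adj_of_adj_of_adj ht.ne hs hu hst.symm htu

/-- A neighbor of `s` on the same level has the same parent. The right side no longer mentions `x`,
so the color of `(r, s)` alone determines its counts. -/
theorem IsBlockForest.children_class (hG : G.IsBlockForest) {r x s : V}
    (hs : s ∈ G.children r x) (p : V → Prop) :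
    {u | u ∈ G.children r x ∧ (s = u ∨ G.Adj s u) ∧ p u} =
      {u | (G.dist r u = G.dist r s ∧ p u) ∧ (u = s ∨ G.Adj u s)} := by
  ext u
  constructor
  · rintro ⟨⟨_, hu⟩, hsu, hp⟩
    exact ⟨⟨hu.trans hs.2.symm, hp⟩, hsu.imp Eq.symm Adj.symm⟩
  · rintro ⟨⟨hu, hp⟩, hus⟩
    refine ⟨?_, hus.imp Eq.symm Adj.symm, hp⟩
    rcases hus with rfl | hus
    · exact hs
    · exact ⟨hG.adj_of_adj hs.1 hus.symm hs.2 (hu.trans hs.2), hu.trans hs.2⟩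

/-- A vertex chosen in the connected component of `x`. -/
noncomputable def root (G : SimpleGraph V) (x : V) : V := Quot.out (G.connectedComponentMk x)

theorem reachable_root (x : V) : G.Reachable (G.root x) x :=
  ConnectedComponent.exact (Quot.out_eq (G.connectedComponentMk x))

theorem Reachable.root_eq {x y : V} (h : G.Reachable x y) : G.root x = G.root y := by
  rw [root, root, ConnectedComponent.sound h]

end BlockForest

/-! ### Building the isomorphism level by level -/

section QuantumIsomorphism

variable {V W A : Type*} [Fintype V] [Fintype W] [CStarAlgebra A] {G : SimpleGraph V}
  {H : SimpleGraph W} [DecidableRel G.Adj] [DecidableRel H.Adj] {U : Matrix W V A}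

theorem IsQuantumIsomorphism.intertwines_dist (hU : IsQuantumIsomorphism G H U) :
    U.Intertwines G.dist H.dist := (Matrix.Intertwines.edist hU).map ENat.toNat

theorem IsQuantumIsomorphism.intertwines_reachable (hU : IsQuantumIsomorphism G H U) :
    U.Intertwines G.Reachable H.Reachable := by
  have h := (Matrix.Intertwines.edist hU).map (fun d => d ≠ ⊤)
  simpa only [edist_ne_top_iff_reachable] using h

theorem IsQuantumIsomorphism.exists_bijOn_children [Nonempty W] (hU : IsQuantumIsomorphism G H U)
    (hG : G.IsBlockForest) (hH : H.IsBlockForest) {r x : V} {r' x' : W}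
    (hc : U.colColor r x = U.rowColor r' x') :
    ∃ ψ : V → W, Set.BijOn ψ (G.children r x) (H.children r' x') ∧
      (∀ w ∈ G.children r x, U.rowColor r' (ψ w) = U.colColor r w) ∧
      ∀ w ∈ G.children r x, ∀ z ∈ G.children r x,
        (w = z ∨ G.Adj w z) ↔ (ψ w = ψ z ∨ H.Adj (ψ w) (ψ z)) := by
  have hM := hU.isMagicUnitary
  have hadj := Matrix.Intertwines.adj hU
  have hdc := hU.intertwines_dist.prodMk U.intertwines_color
  have hd : G.dist r x = H.dist r' x' := hU.intertwines_dist.eq_of_color_eq hc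
  refine Set.exists_bijOn_of_ncard_class_eq (fun w => U.colColor r w) (fun w => U.rowColor r' w)
    (fun w z => w = z ∨ G.Adj w z) (fun w z => w = z ∨ H.Adj w z)
    (fun _ => Or.inl rfl) (fun _ _ h => h.imp Eq.symm Adj.symm)
    (fun _ _ h => h.imp Eq.symm Adj.symm) _ _ hG.children_trans hH.children_trans ?_ ?_
  · intro c
    have h := (hdc.ncard hM hadj
      (fun p e => (p.1 = G.dist r x + 1 ∧ p.2 = c) ∧ e)).eq_of_color_eq hc
    rw [hd] at h
    convert h using 2
    · ext u
      simp only [children, Set.mem_ofPred_eq, adj_comm, hd]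
      tauto
    · ext u
      simp only [children, Set.mem_ofPred_eq, adj_comm]
      tauto
  · intro s hs t ht hst c
    have h := (hdc.ncard hM ((Matrix.Intertwines.eq hM).prodMk hadj)
      (fun p e => (p.1 = G.dist r s ∧ p.2 = c) ∧ (e.1 ∨ e.2))).eq_of_color_eq hst
    have hd' : G.dist r s = H.dist r' t := hU.intertwines_dist.eq_of_color_eq hst
    rw [hG.children_class hs, hH.children_class ht, ← hd']
    exact h

/-- The matching lemma, with components as classes and the colors of `(x, x)`. It supplies the
images of the roots, in distinct components, and the equality of vertex numbers. -/
theorem IsQuantumIsomorphism.exists_bijective_diag [Nonempty W] [Nontrivial A]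
    (hU : IsQuantumIsomorphism G H U) :
    ∃ θ : V → W, Function.Bijective θ ∧ (∀ x, U.colColor x x = U.rowColor (θ x) (θ x)) ∧
      ∀ x y, G.Reachable x y ↔ H.Reachable (θ x) (θ y) := by
  have hM := hU.isMagicUnitary
  have hcol := U.intertwines_color
  obtain ⟨θ, hθ, hθc, hθr⟩ := Set.exists_bijOn_of_ncard_class_eq (fun x => U.colColor x x)
    (fun a => U.rowColor a a) G.Reachable H.Reachable (fun s => Reachable.refl s)
    (fun _ _ h => h.symm) (fun _ _ h => h.symm) Set.univ Set.univ
    (fun _ _ _ _ _ _ h h' => h.trans h') (fun _ _ _ _ _ _ h h' => h.trans h')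
    (by
      intro c
      simpa using hcol.ncard_diag hM (fun d => d = c))
    (by
      intro s _ t _ hst c
      have h := ((hU.intertwines_reachable.prodMk (hcol.diag hM)).ncard hM hcol
        (fun p _ => p.1 ∧ p.2 = c)).eq_of_color_eq hst
      simpa using h)
  exact ⟨θ, Set.bijOn_univ.1 hθ, fun x => (hθc x trivial).symm,
    fun x y => hθr x trivial y trivial⟩

/-- The color invariant fixes the level and component of each image and permits the next step: below
every vertex of level `n`, the children are mapped by a bijection respecting colors and cliques.
Unique and common parents in both graphs exclude all other edges. -/
theorem IsQuantumIsomorphism.exists_partial_embedding [Nonempty W]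
    (hU : IsQuantumIsomorphism G H U) (hG : G.IsBlockForest) (hH : H.IsBlockForest)
    {θ : V → W} (hθ : Function.Injective θ)
    (hθc : ∀ x, U.colColor x x = U.rowColor (θ x) (θ x))
    (hθr : ∀ x y, G.Reachable x y ↔ H.Reachable (θ x) (θ y)) (n : ℕ) :
    ∃ φ : V → W,
      (∀ x, G.dist (G.root x) x ≤ n →
        U.colColor (G.root x) x = U.rowColor (θ (G.root x)) (φ x)) ∧
      ∀ x y, G.dist (G.root x) x ≤ n → G.dist (G.root y) y ≤ n →
        (φ x = φ y → x = y) ∧ (G.Adj x y ↔ H.Adj (φ x) (φ y)) := by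
  classical
  have hroot : ∀ {φ : V → W} {x y : V},
      U.colColor (G.root x) x = U.rowColor (θ (G.root x)) (φ x) →
      U.colColor (G.root y) y = U.rowColor (θ (G.root y)) (φ y) →
      H.Reachable (φ x) (φ y) → G.root x = G.root y := by
    intro φ x y hx hy hxy
    have hx' : H.Reachable (θ (G.root x)) (φ x) :=
      (iff_of_eq (hU.intertwines_reachable.eq_of_color_eq hx)).1 (reachable_root x)
    have hy' : H.Reachable (θ (G.root y)) (φ y) :=
      (iff_of_eq (hU.intertwines_reachable.eq_of_color_eq hy)).1 (reachable_root y)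
    have h := (hθr _ _).2 (hx'.trans (hxy.trans hy'.symm))
    exact ((reachable_root x).symm.trans (h.trans (reachable_root y))).root_eq
  have hdist : ∀ {φ : V → W} {x : V},
      U.colColor (G.root x) x = U.rowColor (θ (G.root x)) (φ x) →
      G.dist (G.root x) x = H.dist (θ (G.root x)) (φ x) := fun h =>
    hU.intertwines_dist.eq_of_color_eq h
  induction n with
  | zero =>
    -- Level `0` consists of the roots, one per component, so there are no edges to compare.
    have hx0 : ∀ {x}, G.dist (G.root x) x ≤ 0 → G.root x = x := fun {x} hx =>
      (reachable_root x).dist_eq_zero_iff.1 (Nat.le_zero.1 hx)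
    refine ⟨θ, fun x hx => ?_, fun x y hx hy => ⟨fun h => hθ h, ?_⟩⟩
    · rw [hx0 hx]
      exact hθc x
    · have key : G.Reachable x y → x = y := fun h => by
        rw [← hx0 hx, ← hx0 hy, h.root_eq]
      constructor
      · intro h
        exact absurd (key h.reachable) h.ne
      · intro h
        exact absurd (congrArg θ (key ((hθr x y).2 h.reachable))) h.ne
  | succ n ih =>
    obtain ⟨φ, hφ, hφ'⟩ := ih
    have hψ : ∀ x, ∃ ψ : V → W, G.dist (G.root x) x ≤ n →
        Set.BijOn ψ (G.children (G.root x) x) (H.children (θ (G.root x)) (φ x)) ∧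
        (∀ w ∈ G.children (G.root x) x,
          U.rowColor (θ (G.root x)) (ψ w) = U.colColor (G.root x) w) ∧
        ∀ w ∈ G.children (G.root x) x, ∀ z ∈ G.children (G.root x) x,
          (w = z ∨ G.Adj w z) ↔ (ψ w = ψ z ∨ H.Adj (ψ w) (ψ z)) := by
      intro x
      by_cases hx : G.dist (G.root x) x ≤ n
      · obtain ⟨ψ, h⟩ := hU.exists_bijOn_children hG hH (hφ x hx)
        exact ⟨ψ, fun _ => h⟩
      · exact ⟨φ, fun h => absurd h hx⟩
    choose ψ hψ using hψ
    have hpar : ∀ x, ∃ p, G.dist (G.root x) x = n + 1 →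
        G.Adj p x ∧ G.root p = G.root x ∧ G.dist (G.root x) p = n := by
      intro x
      by_cases hx : G.dist (G.root x) x = n + 1
      · obtain ⟨p, hp, hp'⟩ := exists_adj_dist_eq hx
        exact ⟨p, fun _ => ⟨hp, hp.reachable.root_eq, hp'⟩⟩
      · exact ⟨x, fun h => absurd h hx⟩
    choose par hpar using hpar
    have hlow : ∀ {x}, G.dist (G.root x) x = n + 1 →
        G.dist (G.root (par x)) (par x) = n := fun {x} hx => by
      rw [(hpar x hx).2.1]
      exact (hpar x hx).2.2
    have hchild : ∀ {x}, G.dist (G.root x) x = n + 1 →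
        x ∈ G.children (G.root (par x)) (par x) := fun {x} hx => by
      obtain ⟨h1, h2, h3⟩ := hpar x hx
      exact ⟨h1, by rw [h2, h3, hx]⟩
    set φ' : V → W := fun x => if G.dist (G.root x) x ≤ n then φ x else ψ (par x) x
    have hφ'_low : ∀ {x}, G.dist (G.root x) x ≤ n → φ' x = φ x := fun h => if_pos h
    have hφ'_high : ∀ {x}, G.dist (G.root x) x = n + 1 → φ' x = ψ (par x) x := fun h =>
      if_neg (by omega)
    have hmem : ∀ {x}, G.dist (G.root x) x = n + 1 →
        φ' x ∈ H.children (θ (G.root x)) (φ (par x)) := fun {x} hx => by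
      rw [hφ'_high hx, ← (hpar x hx).2.1]
      exact (hψ (par x) (hlow hx).le).1.mapsTo (hchild hx)
    have hcolor : ∀ x, G.dist (G.root x) x ≤ n + 1 →
        U.colColor (G.root x) x = U.rowColor (θ (G.root x)) (φ' x) := by
      intro x hx
      rcases Nat.lt_or_ge n (G.dist (G.root x) x) with h | h
      · have hx' : G.dist (G.root x) x = n + 1 := by omega
        rw [hφ'_high hx', ← (hpar x hx').2.1]
        exact ((hψ (par x) (hlow hx').le).2.1 x (hchild hx')).symm
      · rw [hφ'_low h]
        exact hφ x h
    -- By uniqueness of parents in `H`, `b` is the image of both parents, and `φ` is injective on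
    -- lower levels.
    have hpar_eq : ∀ {x y}, G.dist (G.root x) x = n + 1 → G.dist (G.root y) y = n + 1 →
        G.root x = G.root y → (∃ b, H.dist (θ (G.root x)) b = n ∧ H.Adj b (φ' x) ∧
          H.Adj b (φ' y)) → par x = par y := by
      rintro x y hx hy hr ⟨b, hb, hbx, hby⟩
      have h1 := hmem hx
      have h2 := hmem hy
      have e1 := (hdist (hφ (par x) (hlow hx).le)).symm.trans (hlow hx)
      have e2 := (hdist (hφ (par y) (hlow hy).le)).symm.trans (hlow hy)
      rw [(hpar x hx).2.1] at e1
      rw [(hpar y hy).2.1, ← hr] at e2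
      rw [← hr] at h2
      have e3 := hH.eq_of_dist_eq h1.1 hbx h1.2 (hb.trans e1.symm)
      have e4 := hH.eq_of_dist_eq h2.1 hby h2.2 (hb.trans e2.symm)
      exact (hφ' _ _ (hlow hx).le (hlow hy).le).1 (e3.trans e4.symm)
    -- Levels separate the images, and a vertex of level at most `n` is adjacent to one of level `n
    -- + 1` only as its parent.
    have hmixed : ∀ {x y}, G.dist (G.root x) x ≤ n → G.dist (G.root y) y = n + 1 →
        φ' x ≠ φ' y ∧ (G.Adj x y ↔ H.Adj (φ' x) (φ' y)) := by
      intro x y hx hy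
      have hcx := hcolor x (by omega)
      have hcy := hcolor y (by omega)
      have hdx := hdist hcx
      have hdy := hdist hcy
      constructor
      · intro h
        have hr := hroot hcx hcy (h ▸ Reachable.refl _)
        rw [hr, h] at hdx
        rw [hr] at hx
        omega
      constructor
      · intro h
        have hr := h.reachable.root_eq
        have h1 := h.diff_dist_adj (u := G.root y)
        rw [hr] at hx
        have h2 : x = par y := (hG.eq_of_dist_eq (hpar y hy).1 h
          (by rw [hy, (hpar y hy).2.2]) (by rw [(hpar y hy).2.2]; omega)).symm
        rw [hφ'_low (by rwa [hr]), h2]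
        exact (hmem hy).1
      · intro h
        have hr := hroot hcx hcy h.reachable
        have h1 := h.diff_dist_adj (u := θ (G.root y))
        rw [hr] at hdx
        have hx' := hx
        rw [hr] at hx'
        have e1 := hdist (hφ (par y) (hlow hy).le)
        rw [hlow hy, (hpar y hy).2.1] at e1
        have h2 := hH.eq_of_dist_eq (hmem hy).1 h (hmem hy).2 (by omega)
        rw [hφ'_low hx] at h2
        rw [← (hφ' _ _ (hlow hy).le hx).1 h2]
        exact (hpar y hy).1
    refine ⟨φ', hcolor, fun x y hx hy => ?_⟩
    rcases Nat.lt_or_ge n (G.dist (G.root x) x) with hx' | hx' <;>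
      rcases Nat.lt_or_ge n (G.dist (G.root y) y) with hy' | hy'
    · have hx1 : G.dist (G.root x) x = n + 1 := by omega
      have hy1 : G.dist (G.root y) y = n + 1 := by omega
      have hdx := hdist (hcolor x hx)
      have hdy := hdist (hcolor y hy)
      have ex := (hdist (hφ (par x) (hlow hx1).le)).symm.trans (hlow hx1)
      rw [(hpar x hx1).2.1] at ex
      have hiff : par x = par y →
          ((x = y ∨ G.Adj x y) ↔ (φ' x = φ' y ∨ H.Adj (φ' x) (φ' y))) := by
        intro hp
        have hcy := hchild hy1
        rw [hφ'_high hx1, hφ'_high hy1]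
        rw [← hp] at hcy ⊢
        exact (hψ (par x) (hlow hx1).le).2.2 x (hchild hx1) y hcy
      have hinj : φ' x = φ' y → x = y := by
        intro h
        have hp : par x = par y := hpar_eq hx1 hy1
          (hroot (hcolor x hx) (hcolor y hy) (h ▸ Reachable.refl _))
          ⟨φ (par x), ex, (hmem hx1).1, h ▸ (hmem hx1).1⟩
        have hcy := hchild hy1
        rw [hφ'_high hx1, hφ'_high hy1] at h
        rw [← hp] at hcy h
        exact (hψ (par x) (hlow hx1).le).1.injOn (hchild hx1) hcy h
      refine ⟨hinj, fun h => ?_, fun h => ?_⟩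
      · have hr := h.reachable.root_eq
        rw [← hr] at hy1
        have hpx : par x = par y := by
          obtain ⟨h1, -, h3⟩ := hpar x hx1
          have hxy := hG.adj_of_adj h1 h (by rw [h3, hx1]) (by rw [h3, hy1])
          rw [hr] at hy1 h3
          exact (hG.eq_of_dist_eq hxy (hpar y hy1).1 (by rw [h3, hy1])
            (by rw [h3, (hpar y hy1).2.2]))
        exact ((hiff hpx).1 (Or.inr h)).resolve_left fun e => h.ne (hinj e)
      · have hr := hroot (hcolor x hx) (hcolor y hy) h.reachable
        rw [← hr] at hdy
        rw [hx1] at hdx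
        have hdy' := hdy
        rw [hr, hy1, ← hr] at hdy'
        obtain ⟨b, hbx, hby, hb⟩ := hH.exists_common_parent hdx.symm hdy'.symm h
        exact ((hiff (hpar_eq hx1 hy1 hr ⟨b, hb, hbx, hby⟩)).2 (Or.inr h)).resolve_left
          fun e => h.ne (congrArg φ' e)
    · have h := hmixed hy' (by omega : G.dist (G.root x) x = n + 1)
      exact ⟨fun e => absurd e.symm h.1, by rw [G.adj_comm, H.adj_comm, h.2]⟩
    · have h := hmixed hx' (by omega : G.dist (G.root y) y = n + 1)
      exact ⟨fun e => absurd e h.1, h.2⟩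
    · rw [hφ'_low hx', hφ'_low hy']
      exact hφ' x y hx' hy'

theorem IsQuantumIsomorphism.nonempty_iso [Nontrivial A] (hU : IsQuantumIsomorphism G H U)
    (hG : G.IsBlockForest) : Nonempty (H ≃g G) := by
  have hH := hU.isBlockForest hG
  rcases isEmpty_or_nonempty W with hW | hW
  · have hV : IsEmpty V := ⟨fun x => by
      have := hU.isMagicUnitary.col_sum x
      simp at this⟩
    exact ⟨⟨Equiv.equivOfIsEmpty W V, fun {a} => hW.elim a⟩⟩
  · obtain ⟨θ, hθ, hθc, hθr⟩ := hU.exists_bijective_diag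
    obtain ⟨φ, -, hφ⟩ := hU.exists_partial_embedding hG hH hθ.injective hθc hθr
      -- At the maximal level the partial embedding covers all vertices.
      (Finset.univ.sup fun x => G.dist (G.root x) x)
    have hle : ∀ x, G.dist (G.root x) x ≤ Finset.univ.sup fun x => G.dist (G.root x) x :=
      fun x => Finset.le_sup (f := fun x => G.dist (G.root x) x) (Finset.mem_univ x)
    have hφb : Function.Bijective φ := (Fintype.bijective_iff_injective_and_card φ).2
      ⟨fun x y h => (hφ x y (hle x) (hle y)).1 h, Fintype.card_of_bijective hθ⟩
    exact ⟨Iso.symm ⟨Equiv.ofBijective φ hφb, fun {x y} => (hφ x y (hle x) (hle y)).2.symm⟩⟩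

end QuantumIsomorphism

end SimpleGraph

theorem mainTheorem2 {V : Type u} {W : Type v} [Fintype V] [Fintype W]
    (G : SimpleGraph V) (H : SimpleGraph W) [DecidableRel G.Adj] [DecidableRel H.Adj]
    (hG : G.hyperbolicity = 0) (hGH : SimpleGraph.QuantumIsomorphic.{u, v, w} G H) :
    Nonempty (H ≃g G) ∧ H.hyperbolicity = 0 := by
  obtain ⟨A, _, _, U, hU⟩ := hGH
  obtain ⟨e⟩ := hU.nonempty_iso (SimpleGraph.isBlockForest_of_hyperbolicity_eq_zero hG)
  exact ⟨⟨e⟩, e.hyperbolicity_eq_zero hG⟩
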